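/- Work in $\mathbb{R}^2$ with the Euclidean distance; $B(0,s)$ is the closed ball of radius $s$ around $0$. Fix $\kappa\in\mathbb{N}$. For a finite set $P\subset\mathbb{R}^2$ and distinct $p,q\in P$, call $q$ a $\kappa$-nearest neighbor of $p$ in $P$ if fewer than $\kappa$ points of $P\setminus\{p\}$ are strictly closer to $p$ than $q$. The $\kappa$-nearest-neighbor graph of $P$ is the undirected graph on $P$ in which $p\neq q$ are joined if $q$ is a $\kappa$-nearest neighbor of $p$ or $p$ is one of $q$. Let $H(P)$ be the sum of the lengths of its edges, and $\mathfrak{D}_0(P)=H(P\cup\{0\})-H(P)$. Let $Q_0=[-1/2,1/2]^2$, and for $y\in\mathbb{R}^2$, $n\in\mathbb{N}$ let $\mathcal{C}_{y,n}$ be the closed axis-parallel square with center $y$ and edge length $n^{1/2}$. On a probability space let $\mathcal{P}$ be a homogeneous Poisson process of unit intensity on $\mathbb{R}^2$, and $V_1,V_2,\ldots$ i.i.d. random variables with uniform distribution on $Q_0$. For $x\in Q_0$, $k,n\in\mathbb{N}$ and $y\in\mathbb{R}^2$ put $$P(y,n,k,x)=\big(((\mathcal{P}\cap\mathcal{C}_{y,n})\setminus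 Q_0)\cup\{V_1,\ldots,V_k\}\big)-x .$$ Then there are constants $c_1,c_2>0$, depending only on $\kappa$, such that for all $x\in Q_0$, all $k,n\in\mathbb{N}$ and all $y\in\mathbb{R}^2$ with $\mathcal{C}_{y,n}\cap Q_0\neq\emptyset$ there is an (everywhere finite) random variable $\widetilde S=\widetilde S(y,n,k,x)\ge 0$ with the following two properties. (i) Almost surely, $P(y,n,k,x)\cap B(0,\widetilde S)$ is finite and $$\mathfrak{D}_0\big(P(y,n,k,x)\cap B(0,\widetilde S)\big)=\mathfrak{D}_0\big([P(y,n,k,x)\cap B(0,\widetilde S)]\cup A\big)$$ simultaneously for all finite $A\subset\mathbb{R}^2\setminus B(0,\widetilde S)$ such that $A\subset(\mathcal{C}_{y,n}\cup Q_0)-x$ or $B(0,\widetilde S)\subset\mathcal{C}_{y,n}-x$. (So $A$ is an arbitrary finite set outside the ball if the ball lies in the window, and consists of points of the region that carries the point cloud if the ball reaches over the window boundary.) (ii) $\mathbb{P}(\widetilde S(y,n,k,x)>r)\le c_1\exp(-c_2 r)$ for all $r\in(0,\infty)$. -/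

import Mathlib

open MeasureTheory ProbabilityTheory

noncomputable section

namespace KNN

/-- The Euclidean plane. -/
abbrev Plane : Type := EuclideanSpace ℝ (Fin 2)

/-! ### The nearest-neighbour graph and its total edge length -/

open Classical in
/-- `q` is one of the `κ` nearest neighbours of `p` in the finite point set `P`: fewer than `κ`
points of `P` other than `p` are strictly closer to `p` than `q`.  (Points at equal distance are
all admitted; without ties these are the `κ` nearest points of `P`, or all points of `P` other than
`p` if there are fewer than `κ` of them.) -/
def IsNearestNeighbor (κ : ℕ) (P : Finset Plane) (p q : Plane) : Prop :=
  q ∈ P ∧ q ≠ p ∧ (P.filter fun u => u ≠ p ∧ dist p u < dist p q).card < κ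

/-- The undirected `κ`-nearest-neighbour graph on the finite point set `P`: distinct points of `P`
are joined if at least one of them is among the `κ` nearest neighbours of the other. -/
def knnGraph (κ : ℕ) (P : Finset Plane) : SimpleGraph Plane where
  Adj p q := p ∈ P ∧ q ∈ P ∧ p ≠ q ∧ (IsNearestNeighbor κ P p q ∨ IsNearestNeighbor κ P q p)
  symm := ⟨fun _ _ h => ⟨h.2.1, h.1, h.2.2.1.symm, h.2.2.2.symm⟩⟩
  loopless := ⟨fun _ h => h.2.2.1 rfl⟩

open Classical in
/-- The total edge length `H` of the `κ`-nearest-neighbour graph.  The double sum runs over ordered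
pairs and meets every undirected edge twice. -/
def totalEdgeLength (κ : ℕ) (P : Finset Plane) : ℝ :=
  (∑ p ∈ P, ∑ q ∈ P, if (knnGraph κ P).Adj p q then dist p q else 0) / 2

open Classical in
/-- The add-one cost `H (P ∪ {0}) - H P` of the total edge length. -/
def addOneCost (κ : ℕ) (P : Finset Plane) : ℝ :=
  totalEdgeLength κ (P ∪ {0}) - totalEdgeLength κ P

/-! ### Point processes -/

/-- `Φ` is a homogeneous Poisson process of unit intensity on the plane (as a random locally finite
set): the number of points in a bounded Borel set is a Poisson random variable whose mean is
the area of the set, and the numbers of points in disjoint sets are independent. -/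
structure IsUnitPoissonProcess {Ω : Type*} [MeasurableSpace Ω] (Φ : Ω → Set Plane)
    (μ : Measure Ω) : Prop where
  locallyFinite : ∀ ω, ∀ B : Set Plane, Bornology.IsBounded B → (Φ ω ∩ B).Finite
  measurable_count : ∀ B : Set Plane, MeasurableSet B → Bornology.IsBounded B →
    Measurable fun ω => (Φ ω ∩ B).ncard
  law_count : ∀ B : Set Plane, MeasurableSet B → Bornology.IsBounded B →
    μ.map (fun ω => (Φ ω ∩ B).ncard) = poissonMeasure (volume B).toNNReal
  indep_count : ∀ (m : ℕ) (B : Fin m → Set Plane), (∀ i, MeasurableSet (B i)) →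
    (∀ i, Bornology.IsBounded (B i)) → Pairwise (fun i j => Disjoint (B i) (B j)) →
    iIndepFun (fun i ω => (Φ ω ∩ B i).ncard) μ

/-- The unit square `Q₀ = [-1/2, 1/2]²`. -/
def unitSquare : Set Plane := {u | ∀ i, |u i| ≤ 1 / 2}

/-- The square `C_{y,n}` with centre `y` and edge length `n ^ (1/2)`. -/
def window (y : Plane) (n : ℕ) : Set Plane := {u | ∀ i, |u i - y i| ≤ √(n : ℝ) / 2}

/-- The translate `B - x`. -/
def shift (x : Plane) (B : Set Plane) : Set Plane := (fun u => u - x) '' B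

/-- For a realisation `φ` of the Poisson process and points `v 0, v 1, …`, the point cloud
`((φ ∩ C_{y,n}) \ Q₀ ∪ {v 0, …, v (k - 1)}) - x`. -/
def cloud (φ : Set Plane) (v : ℕ → Plane) (y : Plane) (n k : ℕ) (x : Plane) : Set Plane :=
  shift x ((φ ∩ window y n) \ unitSquare ∪ v '' Set.Iio k)

open Classical in
/-- `s` is a radius of stabilisation at the origin of the point cloud `X`, which lives in
`(C_{y,n} ∪ Q₀) - x`: changing the configuration outside the closed ball `B(0,s)` does not change
the add-one cost.  The points `A` outside the ball range over all finite sets of points of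
`(C_{y,n} ∪ Q₀) - x` and, if the ball lies in the window `C_{y,n} - x`, over all finite
sets of points of the plane. -/
def IsStabilizationRadius (κ : ℕ) (X : Set Plane) (y : Plane) (n : ℕ) (x : Plane) (s : ℝ) : Prop :=
  ∃ F : Finset Plane, (F : Set Plane) = X ∩ Metric.closedBall 0 s ∧
    ∀ A : Finset Plane, (A : Set Plane) ⊆ (Metric.closedBall 0 s)ᶜ →
      ((A : Set Plane) ⊆ shift x (window y n ∪ unitSquare) ∨
        Metric.closedBall 0 s ⊆ shift x (window y n)) →
      addOneCost κ F = addOneCost κ (F ∪ A)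

end KNN

end

/-!
Inserting the origin into a finite set `P` changes the nearest-neighbour graph only near the origin
as soon as the origin is *shielded* at some scale `R` (`Shielded`): the ball of radius `R` holds more
than `κ` points, and every point of norm above `2 * R` has `κ` points nearer than the origin. Then
the new edges end within `2 * R`, and an edge can disappear only if one of its end points gains the
origin as a nearest neighbour, so it lies within `5 * R`; whether two points of that ball are joined
depends only on the points within `15 * R`. Hence points beyond `15 * R` do not influence the add-one
cost, provided the shielding holds with and without them (`Shielded.addOneCost_union`).

Shielding is enforced by eight test boxes of each scale `ρ`. A point `p` with largest coordinate
`p i`, `|p i| ≥ ρ`, is nearer to all points of both test boxes in the direction of `p i`, one on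
each side of the axis, than to the origin (`dist_sub_lt_norm_of_mem_testBox`). Cones would not do
near the boundary of the window, which may cut a cone to a long thin sliver; but if `p` lies in the
window, the side of this square is at least about `ρ`, so the window contains at least one of the
two boxes (`exists_testBox_subset_window`). A scale is *filled* if each test box contained in the
window holds more than `κ` Poisson points. Filled scales give radii of stabilisation
(`IsFilled.isStabilizationRadius`), large scales are always filled since their boxes do not fit into
the window, and a scale `ρ ≥ 32` fails to be filled with probability at most a constant times
`exp (-ρ / 8)`, because the boxes have area at least `ρ / 4`. The radius is
`15` times the least filled scale among the integers from `32` on.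
-/

namespace KNN

/-! ### Locality of the nearest-neighbour graph -/

variable {κ : ℕ}

open Classical in
/-- Whether `q` is a nearest neighbour of `p` depends only on the points in the ball around `p` of
radius `dist p q`, and this ball lies in the ball around the origin of three times the radius of a
centred ball that contains both `p` and `q`. -/
theorem isNearestNeighbor_union_iff {F A : Finset Plane} {S T : ℝ} {p q : Plane}
    (hA : ∀ a ∈ A, S < ‖a‖) (hp : ‖p‖ ≤ T) (hq : ‖q‖ ≤ T) (hTS : 3 * T ≤ S) :
    IsNearestNeighbor κ (F ∪ A) p q ↔ IsNearestNeighbor κ F p q := by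
  have hT : 0 ≤ T := (norm_nonneg p).trans hp
  have hqA : q ∉ A := fun h => by linarith [hA q h]
  have hfilter : (F ∪ A).filter (fun u => u ≠ p ∧ dist p u < dist p q) =
      F.filter fun u => u ≠ p ∧ dist p u < dist p q := by
    ext u
    simp only [Finset.mem_filter, Finset.mem_union]
    refine ⟨fun ⟨hu, hne, hlt⟩ => ⟨hu.resolve_right fun h => ?_, hne, hlt⟩,
      fun ⟨hu, h⟩ => ⟨Or.inl hu, h⟩⟩
    have h1 := hA u h
    have h2 : dist p q ≤ ‖p‖ + ‖q‖ := dist_le_norm_add_norm p q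
    have h3 : ‖u‖ ≤ ‖p‖ + dist p u := by
      rw [dist_comm, dist_eq_norm]
      exact norm_le_insert' u p
    linarith
  unfold IsNearestNeighbor
  rw [hfilter]
  simp [hqA]

open Classical in
theorem knnGraph_union_adj_iff {F A : Finset Plane} {S T : ℝ} {p q : Plane}
    (hA : ∀ a ∈ A, S < ‖a‖) (hp : ‖p‖ ≤ T) (hq : ‖q‖ ≤ T) (hTS : 3 * T ≤ S) :
    (knnGraph κ (F ∪ A)).Adj p q ↔ (knnGraph κ F).Adj p q := by
  have hT : 0 ≤ T := (norm_nonneg p).trans hp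
  have hpA : p ∉ A := fun h => by linarith [hA p h]
  have hqA : q ∉ A := fun h => by linarith [hA q h]
  simp only [knnGraph, isNearestNeighbor_union_iff hA hp hq hTS,
    isNearestNeighbor_union_iff hA hq hp hTS, Finset.mem_union, hpA, hqA, or_false]

open Classical in
theorem IsNearestNeighbor.mono {P P' : Finset Plane} {p q : Plane} (h : P ⊆ P') (hq : q ∈ P)
    (hN : IsNearestNeighbor κ P' p q) : IsNearestNeighbor κ P p q :=
  ⟨hq, hN.2.1, (Finset.card_le_card (Finset.filter_subset_filter _ h)).trans_lt hN.2.2⟩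

/-! ### The edges affected by inserting the origin -/

open Classical in
/-- The origin is shielded at scale `R` in `P`: the ball of radius `R` holds more than `κ` points
of `P`, and every point of `P` of norm larger than `2 * R` has at least `κ` points of `P` nearer
than the origin. -/
structure Shielded (κ : ℕ) (P : Finset Plane) (R : ℝ) : Prop where
  card_ball : κ < (P.filter fun u => ‖u‖ ≤ R).card
  card_nearer : ∀ p ∈ P, 2 * R < ‖p‖ → κ ≤ (P.filter fun u => u ≠ p ∧ dist p u < ‖p‖).card

theorem Shielded.nonneg {P : Finset Plane} {R : ℝ} (h : Shielded κ P R) : 0 ≤ R := by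
  obtain ⟨u, hu⟩ := Finset.card_pos.1 (Nat.zero_lt_of_lt h.card_ball)
  exact (norm_nonneg u).trans (Finset.mem_filter.1 hu).2

open Classical in
theorem Shielded.norm_le_of_isNearestNeighbor_zero {P : Finset Plane} {R : ℝ}
    (h : Shielded κ P R) (h0 : (0 : Plane) ∉ P) {q : Plane}
    (hN : IsNearestNeighbor κ (P ∪ {0}) 0 q) : ‖q‖ ≤ R := by
  by_contra! hq
  refine absurd (hN.2.2.trans h.card_ball) (not_lt.2 (Finset.card_le_card fun u hu => ?_))
  simp only [Finset.mem_filter, Finset.mem_union, dist_zero_left] at hu ⊢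
  exact ⟨Or.inl hu.1, fun h' => h0 (h' ▸ hu.1), hu.2.trans_lt hq⟩

open Classical in
theorem Shielded.norm_le_of_zero_isNearestNeighbor {P : Finset Plane} {R : ℝ}
    (h : Shielded κ P R) {p : Plane} (hp : p ∈ P)
    (hN : IsNearestNeighbor κ (P ∪ {0}) p 0) : ‖p‖ ≤ 2 * R := by
  by_contra! hlt
  refine absurd (hN.2.2.trans_le (h.card_nearer p hp hlt))
    (not_lt.2 (Finset.card_le_card fun u hu => ?_))
  simp only [Finset.mem_filter, Finset.mem_union, dist_zero_right] at hu ⊢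
  exact ⟨Or.inl hu.1, hu.2⟩

open Classical in
/-- A point `q` can cease to be a nearest neighbour of `p` only if the origin becomes one, so `p`
is close to the origin, and then so is `q`, since `p` has `κ` other points nearby. -/
theorem Shielded.norm_le_of_not_iff {P : Finset Plane} {R : ℝ} (h : Shielded κ P R)
    {p q : Plane} (hp : p ∈ P) (hq : q ∈ P)
    (hN : ¬(IsNearestNeighbor κ (P ∪ {0}) p q ↔ IsNearestNeighbor κ P p q)) :
    ‖p‖ ≤ 5 * R ∧ ‖q‖ ≤ 5 * R := by
  have hR := h.nonneg
  have hmono : IsNearestNeighbor κ (P ∪ {0}) p q → IsNearestNeighbor κ P p q :=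
    IsNearestNeighbor.mono Finset.subset_union_left hq
  have hP : IsNearestNeighbor κ P p q := by tauto
  have hP0 : ¬ IsNearestNeighbor κ (P ∪ {0}) p q := by tauto
  have hp2 : ‖p‖ ≤ 2 * R := by
    by_contra! hlt
    have hlt' : dist p q < ‖p‖ := by
      by_contra! hge
      refine absurd (hP.2.2.trans_le (h.card_nearer p hp hlt))
        (not_lt.2 (Finset.card_le_card fun u hu => ?_))
      simp only [Finset.mem_filter] at hu ⊢
      exact ⟨hu.1, hu.2.1, hu.2.2.trans_le hge⟩
    refine hP0 ⟨Finset.mem_union_left _ hq, hP.2.1, lt_of_le_of_lt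
      (Finset.card_le_card fun u hu => ?_) hP.2.2⟩
    simp only [Finset.mem_filter, Finset.mem_union, Finset.mem_singleton] at hu ⊢
    refine ⟨hu.1.resolve_right ?_, hu.2⟩
    rintro rfl
    rw [dist_zero_right] at hu
    exact absurd hu.2.2 hlt'.le.not_gt
  have hpq : dist p q ≤ 3 * R := by
    by_contra! hlt
    have hsub : (P.filter fun u => ‖u‖ ≤ R).erase p ⊆
        P.filter fun u => u ≠ p ∧ dist p u < dist p q := fun u hu => by
      simp only [Finset.mem_filter, Finset.mem_erase] at hu ⊢
      exact ⟨hu.2.1, hu.1, by linarith [dist_le_norm_add_norm p u, hu.2.2]⟩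
    have h1 := Finset.card_le_card hsub
    have h2 := Finset.pred_card_le_card_erase (s := P.filter fun u => ‖u‖ ≤ R) (a := p)
    have h3 := hP.2.2
    have h4 := h.card_ball
    omega
  have hq5 : ‖q‖ ≤ ‖p‖ + dist p q := by
    rw [dist_comm, dist_eq_norm]
    exact norm_le_insert' q p
  constructor <;> linarith

open Classical in
theorem Shielded.norm_le_of_adj_not_iff {P : Finset Plane} {R : ℝ} (h : Shielded κ P R)
    {p q : Plane} (hN : ¬((knnGraph κ (P ∪ {0})).Adj p q ↔ (knnGraph κ P).Adj p q)) :
    ‖p‖ ≤ 5 * R ∧ ‖q‖ ≤ 5 * R := by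
  have hR := h.nonneg
  have h0 : (0 : Plane) ∉ P := fun h0 => by
    rw [Finset.union_eq_left.2 (Finset.singleton_subset_iff.2 h0)] at hN
    exact hN Iff.rfl
  have key : ∀ p ∈ P, IsNearestNeighbor κ (P ∪ {0}) p 0 ∨ IsNearestNeighbor κ (P ∪ {0}) 0 p →
      ‖p‖ ≤ 5 * R := by
    rintro p hp (h1 | h1)
    · linarith [h.norm_le_of_zero_isNearestNeighbor hp h1]
    · linarith [h.norm_le_of_isNearestNeighbor_zero h0 h1]
  have hz : ‖(0 : Plane)‖ ≤ 5 * R := by rw [norm_zero]; positivity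
  by_cases hp : p ∈ P <;> by_cases hq : q ∈ P
  · have hor : ¬(IsNearestNeighbor κ (P ∪ {0}) p q ↔ IsNearestNeighbor κ P p q) ∨
        ¬(IsNearestNeighbor κ (P ∪ {0}) q p ↔ IsNearestNeighbor κ P q p) := by
      by_contra! hc
      exact hN (by simp only [knnGraph, hc.1, hc.2, hp, hq, Finset.mem_union, true_or])
    rcases hor with h' | h'
    · exact h.norm_le_of_not_iff hp hq h'
    · exact (h.norm_le_of_not_iff hq hp h').symm
  all_goals
    have hadj : (knnGraph κ (P ∪ {0})).Adj p q := by
      by_contra hc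
      exact hN (iff_of_false hc fun h' => by simp_all [knnGraph])
    obtain ⟨hp', hq', hne, hnn⟩ := hadj
    simp only [Finset.mem_union, Finset.mem_singleton, hp, hq, false_or] at hp' hq'
  · subst hq'
    exact ⟨key p hp hnn, hz⟩
  · subst hp'
    exact ⟨hz, key q hq hnn.symm⟩
  · exact absurd (hp'.trans hq'.symm) hne

open Classical in
/-- If inserting the origin affects only edges inside the ball of radius `T`, the add-one cost is a
sum over pairs of points in that ball. -/
theorem addOneCost_eq_sum {P : Finset Plane} {T : ℝ}
    (h : ∀ p q, ¬((knnGraph κ (P ∪ {0})).Adj p q ↔ (knnGraph κ P).Adj p q) → ‖p‖ ≤ T ∧ ‖q‖ ≤ T) :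
    addOneCost κ P =
      (∑ p ∈ (P ∪ {0}).filter (fun u => ‖u‖ ≤ T), ∑ q ∈ (P ∪ {0}).filter (fun u => ‖u‖ ≤ T),
        ((if (knnGraph κ (P ∪ {0})).Adj p q then dist p q else 0) -
          if (knnGraph κ P).Adj p q then dist p q else 0)) / 2 := by
  have hext : (∑ p ∈ P, ∑ q ∈ P, if (knnGraph κ P).Adj p q then dist p q else 0) =
      ∑ p ∈ P ∪ {0}, ∑ q ∈ P ∪ {0}, if (knnGraph κ P).Adj p q then dist p q else 0 := by
    rw [← Finset.sum_subset (Finset.subset_union_left (s₁ := P) (s₂ := {0}))]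
    · refine Finset.sum_congr rfl fun p _ => Finset.sum_subset Finset.subset_union_left
        fun q _ hq => if_neg fun h' => hq h'.2.1
    · exact fun p _ hp => Finset.sum_eq_zero fun q _ => if_neg fun h' => hp h'.1
  unfold addOneCost totalEdgeLength
  rw [hext, ← sub_div, ← Finset.sum_sub_distrib]
  congr 1
  have hzero : ∀ p q, ¬(‖p‖ ≤ T ∧ ‖q‖ ≤ T) →
      ((if (knnGraph κ (P ∪ {0})).Adj p q then dist p q else 0) -
          if (knnGraph κ P).Adj p q then dist p q else 0) = 0 := fun p q hpq => by
    simp only [not_not.1 (mt (h p q) hpq), sub_self]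
  rw [← Finset.sum_subset (Finset.filter_subset (fun u => ‖u‖ ≤ T) (P ∪ {0}))]
  · refine Finset.sum_congr rfl fun p _ => ?_
    rw [← Finset.sum_sub_distrib]
    refine (Finset.sum_subset (Finset.filter_subset _ _) fun q hq hq' => hzero p q ?_).symm
    exact fun h' => hq' (Finset.mem_filter.2 ⟨hq, h'.2⟩)
  · intro p hp hp'
    rw [← Finset.sum_sub_distrib]
    refine Finset.sum_eq_zero fun q _ => hzero p q ?_
    exact fun h' => hp' (Finset.mem_filter.2 ⟨hp, h'.1⟩)

open Classical in
/-- If the origin is shielded at scale `R` both without and with the points of `A`, which lie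
outside the ball of radius `15 * R`, then `A` does not influence the add-one cost. -/
theorem Shielded.addOneCost_union {F A : Finset Plane} {R : ℝ} (hF : Shielded κ F R)
    (hFA : Shielded κ (F ∪ A) R) (hA : ∀ a ∈ A, 15 * R < ‖a‖) :
    addOneCost κ F = addOneCost κ (F ∪ A) := by
  rw [addOneCost_eq_sum fun p q => hF.norm_le_of_adj_not_iff,
    addOneCost_eq_sum fun p q => hFA.norm_le_of_adj_not_iff]
  have hR := hF.nonneg
  have hset : F ∪ A ∪ {0} = F ∪ {0} ∪ A := Finset.union_right_comm F A {0}
  have hfilter : (F ∪ A ∪ {0}).filter (fun u => ‖u‖ ≤ 5 * R) =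
      (F ∪ {0}).filter fun u => ‖u‖ ≤ 5 * R := by
    rw [hset, Finset.filter_union,
      Finset.filter_false_of_mem (s := A) fun a ha => by linarith [hA a ha], Finset.union_empty]
  rw [hfilter, hset]
  congr 1
  refine Finset.sum_congr rfl fun p hp => Finset.sum_congr rfl fun q hq => ?_
  have hp := (Finset.mem_filter.1 hp).2
  have hq := (Finset.mem_filter.1 hq).2
  simp only [knnGraph_union_adj_iff hA hp hq (by linarith : 3 * (5 * R) ≤ 15 * R)]

/-! ### Test boxes -/

/-- The lower end of the `j`-th side of a test box whose long axis is `i`. -/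
noncomputable def boxLower (ρ : ℝ) (i j : Fin 2) : ℝ := if j = i then ρ / 4 else 1

/-- The upper end of the `j`-th side of a test box whose long axis is `i`. -/
noncomputable def boxUpper (ρ : ℝ) (i j : Fin 2) : ℝ := if j = i then ρ / 2 else ρ / 16

/-- The test box of scale `ρ` at `x` with long axis `i` and signs `ε`: relative to `x`, the `i`-th
coordinate has sign `ε i` and modulus in `[ρ / 4, ρ / 2]`, the other one has sign `ε j` and modulus
in `[1, ρ / 16]`. There are eight test boxes of each scale. -/
def testBox (x : Plane) (ρ : ℝ) (i : Fin 2) (ε : Fin 2 → ℤˣ) : Set Plane :=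
  {u | ∀ j, ((ε j : ℤ) : ℝ) * (u j - x j) ∈ Set.Icc (boxLower ρ i j) (boxUpper ρ i j)}

theorem setOf_sign_mul_sub_mem_Icc (e : ℤˣ) (c a b : ℝ) :
    {t : ℝ | ((e : ℤ) : ℝ) * (t - c) ∈ Set.Icc a b} =
      if e = 1 then Set.Icc (c + a) (c + b) else Set.Icc (c - b) (c - a) := by
  rcases Int.units_eq_one_or e with rfl | rfl
  · ext t
    simp only [Units.val_one, Int.cast_one, one_mul, Set.mem_ofPred_eq, Set.mem_Icc, if_true]
    constructor <;> rintro ⟨h1, h2⟩ <;> constructor <;> linarith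
  · ext t
    rw [if_neg (by decide)]
    simp only [Units.val_neg, Units.val_one, Int.cast_neg, Int.cast_one, Set.mem_ofPred_eq,
      Set.mem_Icc]
    constructor <;> rintro ⟨h1, h2⟩ <;> constructor <;> linarith

theorem testBox_eq_preimage (x : Plane) (ρ : ℝ) (i : Fin 2) (ε : Fin 2 → ℤˣ) :
    testBox x ρ i ε = WithLp.ofLp ⁻¹' (Set.univ.pi fun j =>
      {t : ℝ | ((ε j : ℤ) : ℝ) * (t - x j) ∈ Set.Icc (boxLower ρ i j) (boxUpper ρ i j)}) := by
  ext u
  simp [testBox]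

theorem measurableSet_setOf_sign_mul_sub_mem_Icc (e : ℤˣ) (c a b : ℝ) :
    MeasurableSet {t : ℝ | ((e : ℤ) : ℝ) * (t - c) ∈ Set.Icc a b} := by
  rw [setOf_sign_mul_sub_mem_Icc]
  split_ifs <;> exact measurableSet_Icc

theorem measurableSet_testBox (x : Plane) (ρ : ℝ) (i : Fin 2) (ε : Fin 2 → ℤˣ) :
    MeasurableSet (testBox x ρ i ε) := by
  rw [testBox_eq_preimage]
  exact (PiLp.volume_preserving_ofLp (Fin 2)).measurable
    (MeasurableSet.univ_pi fun j => measurableSet_setOf_sign_mul_sub_mem_Icc _ _ _ _)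

theorem volume_testBox (x : Plane) {ρ : ℝ} (hρ : 0 ≤ ρ) (i : Fin 2) (ε : Fin 2 → ℤˣ) :
    volume (testBox x ρ i ε) = ENNReal.ofReal (ρ / 4 * (ρ / 16 - 1)) := by
  have hside : ∀ j, volume {t : ℝ | ((ε j : ℤ) : ℝ) * (t - x j) ∈
      Set.Icc (boxLower ρ i j) (boxUpper ρ i j)} =
        ENNReal.ofReal (boxUpper ρ i j - boxLower ρ i j) := fun j => by
    rw [setOf_sign_mul_sub_mem_Icc]
    split_ifs <;> rw [Real.volume_Icc] <;> congr 1 <;> ring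
  rw [testBox_eq_preimage, (PiLp.volume_preserving_ofLp (Fin 2)).measure_preimage
    (MeasurableSet.univ_pi fun j =>
      measurableSet_setOf_sign_mul_sub_mem_Icc _ _ _ _).nullMeasurableSet, volume_pi_pi]
  simp only [hside, Fin.prod_univ_two]
  fin_cases i
  · simp only [boxUpper, boxLower, Fin.zero_eta, Fin.isValue, if_true, one_ne_zero, if_false]
    rw [← ENNReal.ofReal_mul (by linarith)]
    congr 1; ring
  · simp only [boxUpper, boxLower, Fin.mk_one, Fin.isValue, if_true, zero_ne_one, if_false]
    rw [mul_comm, ← ENNReal.ofReal_mul (by linarith)]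
    congr 1; ring

theorem abs_sign_mul (e : ℤˣ) (t : ℝ) : |((e : ℤ) : ℝ) * t| = |t| := by
  rcases Int.units_eq_one_or e with rfl | rfl <;> simp

theorem abs_sub_mem_of_mem_testBox {x : Plane} {ρ : ℝ} (hρ : 0 ≤ ρ) {i : Fin 2} {ε : Fin 2 → ℤˣ}
    {u : Plane} (hu : u ∈ testBox x ρ i ε) (j : Fin 2) :
    |u j - x j| ∈ Set.Icc (boxLower ρ i j) (boxUpper ρ i j) := by
  have h := hu j
  have h0 : 0 ≤ boxLower ρ i j := by unfold boxLower; split_ifs <;> linarith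
  rwa [← abs_sign_mul (ε j), abs_of_nonneg (h0.trans h.1)]

theorem norm_sub_le_of_mem_testBox {x : Plane} {ρ : ℝ} (hρ : 0 ≤ ρ) {i : Fin 2} {ε : Fin 2 → ℤˣ}
    {u : Plane} (hu : u ∈ testBox x ρ i ε) : ‖u - x‖ ≤ ρ := by
  have h : ∀ j, (u j - x j) ^ 2 ≤ (ρ / 2) ^ 2 := fun j => by
    refine sq_le_sq' ?_ ?_ <;>
    · have h1 := (abs_sub_mem_of_mem_testBox hρ hu j).2
      have h2 : boxUpper ρ i j ≤ ρ / 2 := by unfold boxUpper; split_ifs <;> linarith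
      linarith [neg_abs_le (u j - x j), le_abs_self (u j - x j)]
  refine abs_le_of_sq_le_sq' ?_ hρ |>.2
  rw [EuclideanSpace.real_norm_sq_eq, Fin.sum_univ_two]
  simp only [PiLp.sub_apply]
  nlinarith [h 0, h 1]

theorem isBounded_testBox (x : Plane) {ρ : ℝ} (hρ : 0 ≤ ρ) (i : Fin 2) (ε : Fin 2 → ℤˣ) :
    Bornology.IsBounded (testBox x ρ i ε) :=
  Metric.isBounded_closedBall.subset fun u hu => by
    rw [Metric.mem_closedBall, dist_eq_norm]
    exact norm_sub_le_of_mem_testBox hρ hu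

theorem sq_sub_add_sq_sub_lt {ρ a b s t : ℝ} (hρ : 0 < ρ) (ha : ρ ≤ a) (hb : |b| ≤ a)
    (hs : s ∈ Set.Icc (ρ / 4) (ρ / 2)) (ht : |t| ≤ ρ / 16) :
    (a - s) ^ 2 + (b - t) ^ 2 < a ^ 2 + b ^ 2 := by
  have hbt : |b * t| ≤ a * (ρ / 16) := by
    rw [abs_mul]
    exact mul_le_mul hb ht (abs_nonneg t) (by linarith)
  have htt : t ^ 2 ≤ a * (ρ / 16) := by
    rw [← sq_abs]
    nlinarith [abs_nonneg t]
  have hss : s * s ≤ s * (a / 2) :=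
    mul_le_mul_of_nonneg_left (by linarith [hs.2]) (by linarith [hs.1])
  have has : a * (ρ / 4) ≤ a * s := mul_le_mul_of_nonneg_left hs.1 (by linarith)
  have hapos : 0 < a * ρ := mul_pos (by linarith) hρ
  nlinarith [neg_abs_le (b * t)]

/-- The points of a test box are nearer than the centre `x` to every point whose largest
coordinate relative to `x` is the one along the long axis, has the sign of the box, and is at
least the scale of the box. The sign of the short coordinate is irrelevant. -/
theorem dist_sub_lt_norm_of_mem_testBox {x p u : Plane} {ρ : ℝ} (hρ : 0 < ρ) {i : Fin 2}
    {ε : Fin 2 → ℤˣ} (hu : u ∈ testBox x ρ i ε) (hmax : ∀ j, |p j| ≤ |p i|) (hp : ρ ≤ |p i|)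
    (hε : ((ε i : ℤ) : ℝ) * p i = |p i|) : dist p (u - x) < ‖p‖ := by
  have hs : ((ε i : ℤ) : ℝ) * (u i - x i) ∈ Set.Icc (ρ / 4) (ρ / 2) := by
    simpa [boxLower, boxUpper] using hu i
  have ht : ∀ j ≠ i, |u j - x j| ≤ ρ / 16 := fun j hj => by
    simpa [boxUpper, hj] using (abs_sub_mem_of_mem_testBox hρ.le hu j).2
  have hsign : (((ε i : ℤ) : ℝ) * p i - ((ε i : ℤ) : ℝ) * (u i - x i)) ^ 2 =
      (p i - (u i - x i)) ^ 2 := by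
    rw [← mul_sub, mul_pow]
    rcases Int.units_eq_one_or (ε i) with h | h <;> simp [h]
  have key : ∀ j ≠ i, (p i - (u i - x i)) ^ 2 + (p j - (u j - x j)) ^ 2 < p i ^ 2 + p j ^ 2 :=
    fun j hj => by
      have h := sq_sub_add_sq_sub_lt hρ hp (hmax j) hs (ht j hj)
      rwa [← hε, hsign, hε, sq_abs] at h
  rw [dist_eq_norm]
  refine lt_of_pow_lt_pow_left₀ 2 (norm_nonneg p) ?_
  rw [EuclideanSpace.real_norm_sq_eq, EuclideanSpace.real_norm_sq_eq, Fin.sum_univ_two,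
    Fin.sum_univ_two]
  simp only [PiLp.sub_apply]
  fin_cases i
  · exact key 1 (by decide)
  · have h := key 0 (by decide)
    simp only [Fin.mk_one, Fin.isValue] at h
    linarith

theorem exists_sign_mul_eq_abs (t : ℝ) : ∃ e : ℤˣ, ((e : ℤ) : ℝ) * t = |t| := by
  rcases abs_cases t with h | h
  · exact ⟨1, by simp [h.1]⟩
  · exact ⟨-1, by simp [h.1]⟩

/-- If a window that meets the unit square has a point far from `x`, its side is long, so around
`x` it extends far along the short axis of the test boxes in at least one of the two directions.
Hence it contains one of the two test boxes that point towards the far point. -/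
theorem exists_testBox_subset_window {x y p : Plane} {n : ℕ} {ρ : ℝ} (hρ : 16 ≤ ρ)
    (hx : x ∈ unitSquare) (hw : (window y n ∩ unitSquare).Nonempty) (hpw : p + x ∈ window y n)
    {i : Fin 2} (hp : ρ ≤ |p i|) :
    ∃ ε : Fin 2 → ℤˣ, ((ε i : ℤ) : ℝ) * p i = |p i| ∧ testBox x ρ i ε ⊆ window y n := by
  obtain ⟨w, hwW, hwQ⟩ := hw
  have hpi := abs_le.1 (hpw i)
  have hwi := abs_le.1 (hwW i)
  have hwi' := abs_le.1 (hwQ i)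
  have hxi := abs_le.1 (hx i)
  rw [PiLp.add_apply] at hpi
  have key : ∀ l, ∃ e : ℤˣ, (l = i → ((e : ℤ) : ℝ) * p i = |p i|) ∧
      ∀ t : ℝ, ((e : ℤ) : ℝ) * (t - x l) ∈ Set.Icc (boxLower ρ i l) (boxUpper ρ i l) →
        |t - y l| ≤ √(n : ℝ) / 2 := by
    intro l
    by_cases hl : l = i
    · subst hl
      obtain ⟨e, he⟩ := exists_sign_mul_eq_abs (p l)
      refine ⟨e, fun _ => he, fun t ht => abs_le.2 ?_⟩
      simp only [boxLower, boxUpper, if_true, Set.mem_Icc] at ht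
      rw [← he] at hp
      rcases Int.units_eq_one_or e with rfl | rfl
      · norm_num at ht hp
        constructor <;> linarith
      · norm_num at ht hp
        constructor <;> linarith
    · have hwl := abs_le.1 (hwW l)
      have hwl' := abs_le.1 (hwQ l)
      have hxl := abs_le.1 (hx l)
      have hlong : ρ - 1 ≤ √(n : ℝ) := by
        rcases abs_cases (p i) with h | h <;> linarith
      by_cases hside : ρ / 16 ≤ y l + √(n : ℝ) / 2 - x l
      · refine ⟨1, fun h => absurd h hl, fun t ht => abs_le.2 ?_⟩
        simp only [boxLower, boxUpper, hl, if_false, Set.mem_Icc, Units.val_one, Int.cast_one,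
          one_mul] at ht
        constructor <;> linarith
      · refine ⟨-1, fun h => absurd h hl, fun t ht => abs_le.2 ?_⟩
        simp only [boxLower, boxUpper, hl, if_false, Set.mem_Icc, Units.val_neg, Units.val_one,
          Int.cast_neg, Int.cast_one, neg_mul, one_mul] at ht
        constructor <;> linarith
  choose ε hε hbox using key
  exact ⟨ε, hε i rfl, fun u hu l => hbox l (u l) (hu l)⟩

theorem disjoint_testBox_unitSquare {x : Plane} (hx : x ∈ unitSquare) {ρ : ℝ} (hρ : 4 < ρ)
    (i : Fin 2) (ε : Fin 2 → ℤˣ) : Disjoint (testBox x ρ i ε) unitSquare :=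
  Set.disjoint_left.2 fun u hu hu' => by
    have h1 := (abs_sub_mem_of_mem_testBox (by linarith) hu i).1
    simp only [boxLower, if_true] at h1
    linarith [abs_sub (u i) (x i), hu' i, hx i]

/-! ### Filled scales yield radii of stabilisation -/

/-- Every test box of scale `ρ` that lies in the window holds more than `κ` points of `φ`. -/
def IsFilled (κ : ℕ) (φ : Set Plane) (y : Plane) (n : ℕ) (x : Plane) (ρ : ℝ) : Prop :=
  ∀ i ε, testBox x ρ i ε ⊆ window y n → κ < (φ ∩ testBox x ρ i ε).ncard

variable {n k : ℕ} {φ : Set Plane} {v : ℕ → Plane} {x y : Plane} {ρ : ℝ}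

theorem mem_shift_iff {B : Set Plane} {p : Plane} : p ∈ shift x B ↔ p + x ∈ B :=
  ⟨by rintro ⟨u, hu, rfl⟩; simpa using hu, fun h => ⟨p + x, h, by simp⟩⟩

theorem exists_forall_abs_le (p : Plane) : ∃ i, ∀ j, |p j| ≤ |p i| := by
  obtain ⟨i, -, hi⟩ := Finset.exists_max_image Finset.univ (fun j => |p j|) Finset.univ_nonempty
  exact ⟨i, fun j => hi j (Finset.mem_univ j)⟩

theorem norm_le_two_mul_of_abs_le {p : Plane} {i : Fin 2} (hi : ∀ j, |p j| ≤ |p i|) :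
    ‖p‖ ≤ 2 * |p i| := by
  have h : ∀ j, p j ^ 2 ≤ |p i| ^ 2 := fun j => by
    rw [← sq_abs]
    exact pow_le_pow_left₀ (abs_nonneg _) (hi j) 2
  refine (abs_le_of_sq_le_sq' ?_ (by positivity)).2
  rw [EuclideanSpace.real_norm_sq_eq, Fin.sum_univ_two]
  nlinarith [h 0, h 1, sq_nonneg |p i|]

theorem norm_le_two_of_add_mem_unitSquare {p : Plane} (hx : x ∈ unitSquare)
    (hp : p + x ∈ unitSquare) : ‖p‖ ≤ 2 := by
  obtain ⟨i, hi⟩ := exists_forall_abs_le p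
  have h1 := abs_le.1 (hp i)
  have h2 := abs_le.1 (hx i)
  rw [PiLp.add_apply] at h1
  have : |p i| ≤ 1 := abs_le.2 ⟨by linarith, by linarith⟩
  linarith [norm_le_two_mul_of_abs_le hi]

/-- A far point of the region that carries the configuration, or any far point if the window
contains a large ball, has a test box in the window that separates it from the origin. -/
theorem exists_testBox_subset_of_norm_lt {p : Plane} (hρ : 16 ≤ ρ) (hx : x ∈ unitSquare)
    (hw : (window y n ∩ unitSquare).Nonempty) (hp : 2 * ρ < ‖p‖)
    (hpw : p ∈ shift x (window y n ∪ unitSquare) ∨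
      Metric.closedBall 0 ρ ⊆ shift x (window y n)) :
    ∃ i ε, testBox x ρ i ε ⊆ window y n ∧ ∀ u ∈ testBox x ρ i ε, dist p (u - x) < ‖p‖ := by
  obtain ⟨i, hi⟩ := exists_forall_abs_le p
  have hpi : ρ ≤ |p i| := by linarith [norm_le_two_mul_of_abs_le hi]
  have hnear : ∀ ε : Fin 2 → ℤˣ, ((ε i : ℤ) : ℝ) * p i = |p i| →
      ∀ u ∈ testBox x ρ i ε, dist p (u - x) < ‖p‖ := fun ε hε u hu =>
    dist_sub_lt_norm_of_mem_testBox (by linarith) hu hi hpi hε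
  rcases hpw with hpw | hball
  · rcases mem_shift_iff.1 hpw with hpw | hpw
    · obtain ⟨ε, hε, hsub⟩ := exists_testBox_subset_window hρ hx hw hpw hpi
      exact ⟨i, ε, hsub, hnear ε hε⟩
    · linarith [norm_le_two_of_add_mem_unitSquare hx hpw]
  · obtain ⟨e, he⟩ := exists_sign_mul_eq_abs (p i)
    refine ⟨i, fun _ => e, fun u hu => ?_, hnear _ he⟩
    have h := hball (mem_closedBall_zero_iff.2 (norm_sub_le_of_mem_testBox (by linarith) hu))
    simpa using mem_shift_iff.1 h

open Classical in
/-- The Poisson points in a test box belong to the point cloud, since the box avoids the unit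
square, in which the Poisson points are discarded. -/
theorem exists_finset_of_isFilled (hρ : 16 ≤ ρ) (hx : x ∈ unitSquare) (hφ : IsFilled κ φ y n x ρ)
    {F : Finset Plane} {S : ℝ} (hS : ρ ≤ S)
    (hF : (F : Set Plane) = cloud φ v y n k x ∩ Metric.closedBall 0 S)
    {i : Fin 2} {ε : Fin 2 → ℤˣ} (hsub : testBox x ρ i ε ⊆ window y n) :
    ∃ G ⊆ F, κ < G.card ∧ ∀ u ∈ G, u + x ∈ testBox x ρ i ε := by
  have hcard := hφ i ε hsub
  have hfin : (φ ∩ testBox x ρ i ε).Finite := Set.finite_of_ncard_pos (Nat.zero_lt_of_lt hcard)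
  refine ⟨hfin.toFinset.image fun u => u - x, fun u hu => ?_, ?_, fun u hu => ?_⟩
  · obtain ⟨w, hw, rfl⟩ := Finset.mem_image.1 hu
    obtain ⟨hwφ, hwb⟩ := hfin.mem_toFinset.1 hw
    rw [← Finset.mem_coe, hF]
    refine ⟨mem_shift_iff.2 ?_, mem_closedBall_zero_iff.2
      ((norm_sub_le_of_mem_testBox (by linarith) hwb).trans hS)⟩
    rw [sub_add_cancel]
    exact Or.inl ⟨⟨hwφ, hsub hwb⟩,
      Set.disjoint_left.1 (disjoint_testBox_unitSquare hx (by linarith) i ε) hwb⟩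
  · rwa [Finset.card_image_of_injective _ sub_left_injective, ← Set.ncard_eq_toFinset_card _ hfin]
  · obtain ⟨w, hw, rfl⟩ := Finset.mem_image.1 hu
    rw [sub_add_cancel]
    exact (hfin.mem_toFinset.1 hw).2

open Classical in
theorem shielded_of_isFilled (hρ : 16 ≤ ρ) (hx : x ∈ unitSquare) (hφ : IsFilled κ φ y n x ρ)
    {F P : Finset Plane} {S : ℝ} (hS : ρ ≤ S)
    (hF : (F : Set Plane) = cloud φ v y n k x ∩ Metric.closedBall 0 S) (hFP : F ⊆ P)
    (hbox : ∃ i ε, testBox x ρ i ε ⊆ window y n)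
    (hP : ∀ p ∈ P, 2 * ρ < ‖p‖ →
      ∃ i ε, testBox x ρ i ε ⊆ window y n ∧ ∀ u ∈ testBox x ρ i ε, dist p (u - x) < ‖p‖) :
    Shielded κ P ρ where
  card_ball := by
    obtain ⟨i, ε, hsub⟩ := hbox
    obtain ⟨G, hGF, hG, hGb⟩ := exists_finset_of_isFilled hρ hx hφ hS hF hsub
    refine hG.trans_le (Finset.card_le_card fun u hu => Finset.mem_filter.2 ⟨hFP (hGF hu), ?_⟩)
    simpa using norm_sub_le_of_mem_testBox (by linarith) (hGb u hu)
  card_nearer p hp hlt := by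
    obtain ⟨i, ε, hsub, hnear⟩ := hP p hp hlt
    obtain ⟨G, hGF, hG, hGb⟩ := exists_finset_of_isFilled hρ hx hφ hS hF hsub
    have hle : (G.erase p).card ≤ (P.filter fun u => u ≠ p ∧ dist p u < ‖p‖).card :=
      Finset.card_le_card fun u hu => by
        obtain ⟨hne, hu⟩ := Finset.mem_erase.1 hu
        have h := hnear _ (hGb u hu)
        rw [add_sub_cancel_right] at h
        exact Finset.mem_filter.2 ⟨hFP (hGF hu), hne, h⟩
    have h := Finset.pred_card_le_card_erase (s := G) (a := p)
    omega

open Classical in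
/-- Fifteen times a filled scale is a radius of stabilisation: a point of `A` is far away and
admissible, which forces a test box into the window, and so the origin is shielded. The points `v i`
have to lie in the unit square, since a far point outside the region `window y n ∪ unitSquare` need
not have points nearer than the origin. -/
theorem IsFilled.isStabilizationRadius (hφ : IsFilled κ φ y n x ρ) (hρ : 16 ≤ ρ)
    (hx : x ∈ unitSquare) (hw : (window y n ∩ unitSquare).Nonempty)
    (hfin : ∀ B : Set Plane, Bornology.IsBounded B → (φ ∩ B).Finite)
    (hv : ∀ i, v i ∈ unitSquare) :
    IsStabilizationRadius κ (cloud φ v y n k x) y n x (15 * ρ) := by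
  have hcloud : cloud φ v y n k x ⊆ shift x (window y n ∪ unitSquare) := by
    refine Set.image_mono (Set.union_subset_union (fun u hu => hu.1.2) ?_)
    rintro _ ⟨i, -, rfl⟩
    exact hv i
  have hXfin : (cloud φ v y n k x ∩ Metric.closedBall 0 (15 * ρ)).Finite := by
    refine ((((hfin (Metric.closedBall x (15 * ρ)) Metric.isBounded_closedBall).union
      ((Set.finite_Iio k).image v)).image fun u => u - x)).subset ?_
    rintro _ ⟨⟨u, hu | hu, rfl⟩, hball⟩
    · exact ⟨u, Or.inl ⟨hu.1.1, by simpa [dist_eq_norm] using hball⟩, rfl⟩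
    · exact ⟨u, Or.inr hu, rfl⟩
  refine ⟨hXfin.toFinset, hXfin.coe_toFinset, fun A hA hAw => ?_⟩
  have hF := hXfin.coe_toFinset
  have hFX : ∀ p ∈ hXfin.toFinset, p ∈ shift x (window y n ∪ unitSquare) := fun p hp =>
    hcloud (hXfin.mem_toFinset.1 hp).1
  generalize hXfin.toFinset = F at hF hFX ⊢
  rcases A.eq_empty_or_nonempty with rfl | ⟨a, ha⟩
  · rw [Finset.union_empty]
  have hAnorm : ∀ a ∈ A, 15 * ρ < ‖a‖ := fun a ha => by
    simpa using hA (Finset.mem_coe.2 ha)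
  have hball : Metric.closedBall 0 (15 * ρ) ⊆ shift x (window y n) →
      Metric.closedBall 0 ρ ⊆ shift x (window y n) :=
    (Metric.closedBall_subset_closedBall (by linarith)).trans
  have hfar : ∀ p ∈ F ∪ A, 2 * ρ < ‖p‖ → ∃ i ε, testBox x ρ i ε ⊆ window y n ∧
      ∀ u ∈ testBox x ρ i ε, dist p (u - x) < ‖p‖ := fun p hp hlt => by
    refine exists_testBox_subset_of_norm_lt hρ hx hw hlt ?_
    rcases Finset.mem_union.1 hp with hp | hp
    · exact Or.inl (hFX p hp)
    · exact hAw.imp (fun h => h hp) hball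
  have hbox : ∃ i ε, testBox x ρ i ε ⊆ window y n := by
    obtain ⟨i, ε, h, -⟩ := hfar a (Finset.mem_union_right _ ha) (by linarith [hAnorm a ha])
    exact ⟨i, ε, h⟩
  have hS : ρ ≤ 15 * ρ := by linarith
  exact (shielded_of_isFilled hρ hx hφ hS hF subset_rfl hbox fun p hp =>
      hfar p (Finset.mem_union_left _ hp)).addOneCost_union
    (shielded_of_isFilled hρ hx hφ hS hF Finset.subset_union_left hbox hfar) hAnorm

/-- Large test boxes do not fit into the window, so large scales are filled for trivial reasons. -/
theorem exists_isFilled (κ : ℕ) (φ : Set Plane) (y : Plane) (n : ℕ) (x : Plane) :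
    ∃ m : ℕ, IsFilled κ φ y n x (m + 32) := by
  obtain ⟨m, hm⟩ := exists_nat_gt (√(n : ℝ) + 2 * (|x 0 - y 0| + |x 1 - y 1|))
  refine ⟨m, fun i ε hsub => ?_⟩
  exfalso
  have hmem : WithLp.toLp 2 (fun j => x j + ((ε j : ℤ) : ℝ) * boxUpper (m + 32) i j) ∈
      testBox x (m + 32) i ε := fun j => by
    have hsq : ((ε j : ℤ) : ℝ) * ((ε j : ℤ) : ℝ) = 1 := by
      rcases Int.units_eq_one_or (ε j) with h | h <;> simp [h]
    have hm0 : (0 : ℝ) ≤ m := m.cast_nonneg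
    simp only [add_sub_cancel_left, ← mul_assoc, hsq, one_mul, Set.mem_Icc, le_refl, and_true]
    unfold boxLower boxUpper
    split_ifs <;> linarith
  have h := hsub hmem i
  simp only [boxUpper, if_true] at h
  have hxy : |x i - y i| ≤ |x 0 - y 0| + |x 1 - y 1| := by
    fin_cases i
    · exact le_add_of_nonneg_right (abs_nonneg _)
    · exact le_add_of_nonneg_left (abs_nonneg _)
  have h1 : |((ε i : ℤ) : ℝ) * (((m : ℝ) + 32) / 2)| = ((m : ℝ) + 32) / 2 := by
    rw [abs_sign_mul, abs_of_nonneg (by positivity)]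
  have h2 := abs_sub (x i + ((ε i : ℤ) : ℝ) * (((m : ℝ) + 32) / 2) - y i) (x i - y i)
  rw [show x i + ((ε i : ℤ) : ℝ) * (((m : ℝ) + 32) / 2) - y i - (x i - y i) =
    ((ε i : ℤ) : ℝ) * (((m : ℝ) + 32) / 2) by ring, h1] at h2
  linarith

/-! ### Uniform points lie in the unit square -/

theorem unitSquare_eq_preimage :
    unitSquare = WithLp.ofLp ⁻¹' (Set.univ.pi fun _ : Fin 2 => Set.Icc (-(1 / 2) : ℝ) (1 / 2)) := by
  ext u
  simp only [unitSquare, Set.mem_ofPred_eq, Set.mem_preimage, Set.mem_univ_pi, Set.mem_Icc, abs_le]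

theorem measurableSet_unitSquare : MeasurableSet unitSquare := by
  rw [unitSquare_eq_preimage]
  exact (PiLp.volume_preserving_ofLp (Fin 2)).measurable
    (MeasurableSet.univ_pi fun _ => measurableSet_Icc)

theorem volume_unitSquare : volume unitSquare = 1 := by
  rw [unitSquare_eq_preimage, (PiLp.volume_preserving_ofLp (Fin 2)).measure_preimage
    (MeasurableSet.univ_pi fun _ => measurableSet_Icc).nullMeasurableSet, volume_pi_pi]
  norm_num [Real.volume_Icc]

theorem ae_mem_unitSquare {Ω : Type*} [MeasurableSpace Ω] {μ : Measure Ω} {X : Ω → Plane}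
    (hX : pdf.IsUniform X unitSquare μ volume) : ∀ᵐ ω ∂μ, X ω ∈ unitSquare := by
  have h := hX.measure_preimage (by simp [volume_unitSquare]) (by simp [volume_unitSquare])
    measurableSet_unitSquare.compl
  rw [Set.inter_compl_self, measure_empty, ENNReal.zero_div] at h
  exact h

/-! ### Tail estimates -/

theorem poissonMeasure_real_Iic_le (r : NNReal) (κ : ℕ) :
    (poissonMeasure r).real (Set.Iic κ) ≤ (κ + 1) * 2 ^ κ * Real.exp (-(r / 2)) := by
  have hterm : ∀ m ∈ Finset.Iic κ,
      (poissonMeasure r).real {m} ≤ 2 ^ κ * Real.exp (-(r / 2)) := fun m hm => by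
    rw [poissonMeasure_real_singleton]
    have h1 := Real.pow_div_factorial_le_exp (x := (r : ℝ) / 2) (by positivity) m
    have h2 : (2 : ℝ) ^ m ≤ 2 ^ κ := pow_le_pow_right₀ (by norm_num) (Finset.mem_Iic.1 hm)
    calc Real.exp (-r) * (r : ℝ) ^ m / m.factorial
        = 2 ^ m * (((r : ℝ) / 2) ^ m / m.factorial) * Real.exp (-r) := by
          rw [div_pow]; field_simp
      _ ≤ 2 ^ κ * Real.exp (r / 2) * Real.exp (-r) := by gcongr
      _ = 2 ^ κ * Real.exp (-(r / 2)) := by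
          rw [mul_assoc, ← Real.exp_add]; congr 2; ring
  rw [← Finset.coe_Iic, ← sum_measureReal_singleton]
  refine (Finset.sum_le_card_nsmul _ _ _ hterm).trans_eq ?_
  rw [Nat.card_Iic, nsmul_eq_mul]
  push_cast
  ring

variable {Ω : Type*} [MeasurableSpace Ω] {μ : Measure Ω} {Φ : Ω → Set Plane}

theorem IsUnitPoissonProcess.measureReal_not_isFilled_le [IsProbabilityMeasure μ]
    (hΦ : IsUnitPoissonProcess Φ μ) (y : Plane) (n : ℕ) (x : Plane) {ρ : ℝ} (hρ : 32 ≤ ρ) :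
    μ.real {ω | ¬ IsFilled κ (Φ ω) y n x ρ} ≤
      8 * ((κ + 1) * 2 ^ κ) * Real.exp (-(ρ / 8)) := by
  have hbox : ∀ b : Fin 2 × (Fin 2 → ℤˣ),
      μ.real {ω | (Φ ω ∩ testBox x ρ b.1 b.2).ncard ≤ κ} ≤
        (κ + 1) * 2 ^ κ * Real.exp (-(ρ / 8)) := fun b => by
    have hm := measurableSet_testBox x ρ b.1 b.2
    have hb := isBounded_testBox x (by linarith : 0 ≤ ρ) b.1 b.2
    have h := map_measureReal_apply (μ := μ) (hΦ.measurable_count _ hm hb)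
      (measurableSet_Iic (a := κ))
    rw [hΦ.law_count _ hm hb] at h
    refine (h.symm.le.trans (poissonMeasure_real_Iic_le _ κ)).trans ?_
    have hvol : ρ / 4 ≤ ((volume (testBox x ρ b.1 b.2)).toNNReal : ℝ) := by
      rw [volume_testBox x (by linarith)]
      change ρ / 4 ≤ (ENNReal.ofReal (ρ / 4 * (ρ / 16 - 1))).toReal
      rw [ENNReal.toReal_ofReal (mul_nonneg (by linarith) (by linarith))]
      nlinarith
    exact mul_le_mul_of_nonneg_left (Real.exp_le_exp.2 (by linarith)) (by positivity)
  have hsub : {ω | ¬ IsFilled κ (Φ ω) y n x ρ} ⊆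
      ⋃ b : Fin 2 × (Fin 2 → ℤˣ), {ω | (Φ ω ∩ testBox x ρ b.1 b.2).ncard ≤ κ} := fun ω hω => by
    simp only [Set.mem_ofPred_eq, IsFilled, not_forall, not_lt] at hω
    obtain ⟨i, ε, -, h⟩ := hω
    exact Set.mem_iUnion.2 ⟨(i, ε), h⟩
  calc μ.real {ω | ¬ IsFilled κ (Φ ω) y n x ρ}
      ≤ ∑ b : Fin 2 × (Fin 2 → ℤˣ), μ.real {ω | (Φ ω ∩ testBox x ρ b.1 b.2).ncard ≤ κ} :=
        (measureReal_mono hsub).trans (measureReal_iUnion_fintype_le _)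
    _ ≤ ∑ _b : Fin 2 × (Fin 2 → ℤˣ), (κ + 1) * 2 ^ κ * Real.exp (-(ρ / 8)) :=
        Finset.sum_le_sum fun b _ => hbox b
    _ = 8 * ((κ + 1) * 2 ^ κ) * Real.exp (-(ρ / 8)) := by
        have hcard : Fintype.card (Fin 2 × (Fin 2 → ℤˣ)) = 8 := by simp
        rw [Finset.sum_const, Finset.card_univ, hcard, nsmul_eq_mul]
        push_cast
        ring

theorem IsUnitPoissonProcess.measurableSet_isFilled (hΦ : IsUnitPoissonProcess Φ μ) (y : Plane)
    (n : ℕ) (x : Plane) {ρ : ℝ} (hρ : 0 ≤ ρ) :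
    MeasurableSet {ω | IsFilled κ (Φ ω) y n x ρ} := by
  have h : {ω | IsFilled κ (Φ ω) y n x ρ} = ⋂ (i : Fin 2) (ε : Fin 2 → ℤˣ)
      (_ : testBox x ρ i ε ⊆ window y n), {ω | κ < (Φ ω ∩ testBox x ρ i ε).ncard} := by
    ext ω
    simp [IsFilled]
  rw [h]
  exact MeasurableSet.iInter fun i => MeasurableSet.iInter fun ε => MeasurableSet.iInter fun _ =>
    measurableSet_lt measurable_const
      (hΦ.measurable_count _ (measurableSet_testBox x ρ i ε) (isBounded_testBox x hρ i ε))

open Classical in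
/-- The least filled scale of the form `m + 32`. -/
noncomputable def filledScale (κ : ℕ) (φ : Set Plane) (y : Plane) (n : ℕ) (x : Plane) : ℝ :=
  (Nat.find (exists_isFilled κ φ y n x) : ℝ) + 32

theorem isFilled_filledScale (κ : ℕ) (φ : Set Plane) (y : Plane) (n : ℕ) (x : Plane) :
    IsFilled κ φ y n x (filledScale κ φ y n x) := by
  classical
  exact Nat.find_spec (exists_isFilled κ φ y n x)

theorem le_filledScale (κ : ℕ) (φ : Set Plane) (y : Plane) (n : ℕ) (x : Plane) :
    32 ≤ filledScale κ φ y n x :=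
  le_add_of_nonneg_left (Nat.cast_nonneg _)

theorem not_isFilled_of_lt_filledScale {φ : Set Plane} {y : Plane} {n : ℕ} {x : Plane} {m : ℕ}
    (hm : 32 ≤ m) (h : (m : ℝ) < filledScale κ φ y n x) : ¬ IsFilled κ φ y n x m := by
  classical
  obtain ⟨j, rfl⟩ := Nat.exists_eq_add_of_le' hm
  push_cast at h ⊢
  exact Nat.find_min (exists_isFilled κ φ y n x) (Nat.cast_lt.1 (lt_of_add_lt_add_right h))

theorem IsUnitPoissonProcess.measurable_filledScale (hΦ : IsUnitPoissonProcess Φ μ) (y : Plane)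
    (n : ℕ) (x : Plane) : Measurable fun ω => filledScale κ (Φ ω) y n x := by
  classical
  have h : Measurable fun ω => Nat.find (exists_isFilled κ (Φ ω) y n x) :=
    measurable_find _ fun m => hΦ.measurableSet_isFilled y n x (by positivity)
  exact (measurable_from_nat.comp h).add_const 32

theorem IsUnitPoissonProcess.measureReal_lt_filledScale_le [IsProbabilityMeasure μ]
    (hΦ : IsUnitPoissonProcess Φ μ) (y : Plane) (n : ℕ) (x : Plane) {t : ℝ} (ht : 0 ≤ t) :
    μ.real {ω | t < filledScale κ (Φ ω) y n x} ≤
      (Real.exp 4 + 8 * ((κ + 1) * 2 ^ κ) * Real.exp (1 / 8)) * Real.exp (-(t / 8)) := by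
  rw [add_mul]
  rcases lt_or_ge t 32 with h32 | h32
  -- Below the least admissible scale the bound exceeds one.
  · refine measureReal_le_one.trans ((Real.one_le_exp ?_ :
      1 ≤ Real.exp (4 + -(t / 8))).trans ?_)
    · linarith
    · rw [Real.exp_add]
      exact le_add_of_nonneg_right (by positivity)
  · have hm : 32 ≤ ⌊t⌋₊ := Nat.le_floor (by exact_mod_cast h32)
    have hsub : {ω | t < filledScale κ (Φ ω) y n x} ⊆
        {ω | ¬ IsFilled κ (Φ ω) y n x (⌊t⌋₊ : ℝ)} := fun ω hω =>
      not_isFilled_of_lt_filledScale hm ((Nat.floor_le ht).trans_lt hω)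
    refine ((measureReal_mono hsub).trans
      (hΦ.measureReal_not_isFilled_le y n x (by exact_mod_cast hm))).trans ?_
    refine le_add_of_nonneg_of_le (by positivity) ?_
    rw [mul_assoc _ (Real.exp (1 / 8)), ← Real.exp_add]
    exact mul_le_mul_of_nonneg_left
      (Real.exp_le_exp.2 (by linarith [Nat.lt_floor_add_one t])) (by positivity)

end KNN

theorem mainTheorem7 (κ : ℕ) :
    ∃ c₁ : ℝ, 0 < c₁ ∧ ∃ c₂ : ℝ, 0 < c₂ ∧
      ∀ (Ω : Type*) [MeasurableSpace Ω] (μ : Measure Ω) [IsProbabilityMeasure μ]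
        (Φ : Ω → Set KNN.Plane) (V : ℕ → Ω → KNN.Plane),
        KNN.IsUnitPoissonProcess Φ μ →
        (∀ i, MeasureTheory.pdf.IsUniform (V i) KNN.unitSquare μ volume) →
        iIndepFun V μ →
        ∀ (y : KNN.Plane) (n k : ℕ) (x : KNN.Plane), x ∈ KNN.unitSquare →
          (KNN.window y n ∩ KNN.unitSquare).Nonempty →
          ∃ S : Ω → ℝ, Measurable S ∧ (∀ ω, 0 ≤ S ω) ∧
            (∀ᵐ ω ∂μ, KNN.IsStabilizationRadius κ
              (KNN.cloud (Φ ω) (fun i => V i ω) y n k x) y n x (S ω)) ∧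
            ∀ r : ℝ, 0 < r → μ.real {ω | r < S ω} ≤ c₁ * Real.exp (-c₂ * r) := by
  refine ⟨Real.exp 4 + 8 * ((κ + 1) * 2 ^ κ) * Real.exp (1 / 8), by positivity,
    1 / 120, by norm_num, ?_⟩
  intro Ω _ μ _ Φ V hΦ hV _ y n k x hx hw
  have hscale : ∀ ω, 32 ≤ KNN.filledScale κ (Φ ω) y n x := fun ω => KNN.le_filledScale _ _ _ _ _
  refine ⟨fun ω => 15 * KNN.filledScale κ (Φ ω) y n x,
    (hΦ.measurable_filledScale y n x).const_mul 15, fun ω => by linarith [hscale ω], ?_, fun r hr => ?_⟩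
  · filter_upwards [ae_all_iff.2 fun i => KNN.ae_mem_unitSquare (hV i)] with ω hω
    exact (KNN.isFilled_filledScale κ (Φ ω) y n x).isStabilizationRadius
      (by linarith [hscale ω]) hx hw (hΦ.locallyFinite ω) hω
  · have hset : {ω | r < 15 * KNN.filledScale κ (Φ ω) y n x} =
        {ω | r / 15 < KNN.filledScale κ (Φ ω) y n x} := by
      ext ω
      simp only [Set.mem_ofPred_eq, div_lt_iff₀' (by norm_num : (0 : ℝ) < 15)]
    rw [hset]
    refine (hΦ.measureReal_lt_filledScale_le y n x (by positivity)).trans_eq ?_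
    congr 2
    ring
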